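/- Fix a real number $0<q<1$. Let $n\ge 0$. The algebra $\mathcal{O}(S^{2n+1}_q)$ is the unital complex $*$-algebra generated by $z_0,\dots,z_n$ with relations $$z_iz_j=qz_jz_i\ (i<j),\qquad z_iz_j^*=qz_j^*z_i\ (i\neq j),\qquad z_iz_i^*=z_i^*z_i+(q^{-2}-1)\sum_{k=i+1}^n z_kz_k^*,\qquad \sum_{k=0}^n z_kz_k^*=1,$$ and $\mathcal{O}(S^{2n}_q)$ has the same generators and relations together with $z_n^*=z_n$. Let $\mathcal{O}(\mathbb{Z}_2)$ be the Hopf algebra generated by a grouplike element $u$ with $u^2=1$, and $\mathcal{O}(U(1))=\mathbb{C}[v,v^{-1}]$ the Hopf algebra of Laurent polynomials with $v$ grouplike; let $\pi_2:\mathcal{O}(U(1))\to\mathcal{O}(\mathbb{Z}_2)$ be the Hopf algebra map $v\mapsto u$. Each $\mathcal{O}(S^m_q)$ is a right $\mathcal{O}(\mathbb{Z}_2)$-comodule algebra with coaction $\rho(z_i)=z_i\otimes u$, $\rho(z_i^*)=z_i^*\otimes u$. Its prolongation is the subalgebra $$\mathcal{O}(S^m_q)\,\square_{\mathcal{O}(\mathbb{Z}_2)}\,\mathcal{O}(U(1))=\{x\in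 \mathcal{O}(S^m_q)\otimes\mathcal{O}(U(1)) : (\rho\otimes\mathrm{id})(x)=(\mathrm{id}\otimes(\pi_2\otimes\mathrm{id})\Delta)(x)\}$$ with the right $\mathcal{O}(U(1))$-coaction obtained by restricting $\mathrm{id}\otimes\Delta$. Let $H$ be a Hopf algebra with bijective antipode $S$. A right $H$-comodule algebra $A$, with coaction $\rho^H$, multiplication $\mu$ and unit map $\eta$, is called principal if it admits a linear map $\ell:H\to A\otimes A$ with $\ell(1)=1\otimes1$, $\mu\circ\ell=\eta\circ\varepsilon$, $(\ell\otimes\mathrm{id})\circ\Delta=(\mathrm{id}\otimes\rho^H)\circ\ell$ and $(S\otimes\ell)\circ\Delta=(\sigma\otimes\mathrm{id})\circ(\rho^H\otimes\mathrm{id})\circ\ell$, where $\sigma$ is the flip. A principal $A$ is cleft if there is a unital, convolution invertible, right $H$-colinear linear map $H\to A$, and trivial if there is a right $H$-colinear homomorphism of unital algebras $H\to A$. **Proposition.** For every natural number $m>1$, the prolongation $\mathcal{O}(S^m_q)\,\square_{\mathcal{O}(\mathbb{Z}_2)}\,\mathcal{O}(U(1))$ is a principal $\mathcal{O}(U(1))$-comodule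 algebra which is not trivial, and indeed not cleft. -/

import Mathlib

open scoped TensorProduct

noncomputable section

/-! ### Comodule algebras -/

/-- The structure of a right `H`-comodule algebra on a complex algebra `A`: a coassociative and
counital coaction `A → A ⊗ H` which is a homomorphism of unital algebras. -/
class RightComoduleAlgebra (H A : Type*) [Ring H] [Bialgebra ℂ H] [Ring A] [Algebra ℂ A] where
  /-- The coaction `ρ`. -/
  coact : A →ₐ[ℂ] A ⊗[ℂ] H
  /-- `(ρ ⊗ id) ∘ ρ = (id ⊗ Δ) ∘ ρ`. -/
  coassoc :
    (Algebra.TensorProduct.assoc ℂ ℂ ℂ A H H).toAlgHom.comp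
        ((Algebra.TensorProduct.map coact (AlgHom.id ℂ H)).comp coact) =
      (Algebra.TensorProduct.map (AlgHom.id ℂ A) (Bialgebra.comulAlgHom ℂ H)).comp coact
  /-- `(id ⊗ ε) ∘ ρ = id`. -/
  counit :
    (Algebra.TensorProduct.rid ℂ ℂ A).toAlgHom.comp
        ((Algebra.TensorProduct.map (AlgHom.id ℂ A) (Bialgebra.counitAlgHom ℂ H)).comp coact) =
      AlgHom.id ℂ A

namespace RightComoduleAlgebra

/-- `j : H → A` has a two-sided inverse for the convolution product `f * g = μ ∘ (f ⊗ g) ∘ Δ`. -/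
def IsConvInvertible {H A : Type*} [Ring H] [Bialgebra ℂ H] [Ring A] [Algebra ℂ A]
    (j : H →ₗ[ℂ] A) : Prop :=
  ∃ k : H →ₗ[ℂ] A,
    LinearMap.mul' ℂ A ∘ₗ TensorProduct.map j k ∘ₗ Coalgebra.comul =
        Algebra.linearMap ℂ A ∘ₗ Coalgebra.counit ∧
      LinearMap.mul' ℂ A ∘ₗ TensorProduct.map k j ∘ₗ Coalgebra.comul =
        Algebra.linearMap ℂ A ∘ₗ Coalgebra.counit

section Principal

variable (H A : Type*) [Ring H] [HopfAlgebra ℂ H] [Ring A] [Algebra ℂ A]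
  [RightComoduleAlgebra H A]

/-- A linear map `ℓ : H → A ⊗ A` is a strong connection if it is unital, `μ ∘ ℓ = η ∘ ε`,
`(ℓ ⊗ id) ∘ Δ = (id ⊗ ρ) ∘ ℓ` and `(S ⊗ ℓ) ∘ Δ = (σ ⊗ id) ∘ (ρ ⊗ id) ∘ ℓ`, where `σ` is the flip
(both sides of the last two equations are compared along the associativity isomorphisms). -/
structure IsStrongConnection (l : H →ₗ[ℂ] A ⊗[ℂ] A) : Prop where
  map_one : l 1 = 1 ⊗ₜ[ℂ] 1
  mul_comp : LinearMap.mul' ℂ A ∘ₗ l = Algebra.linearMap ℂ A ∘ₗ Coalgebra.counit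
  right_colinear :
    (TensorProduct.assoc ℂ A A H).toLinearMap ∘ₗ
        TensorProduct.map l LinearMap.id ∘ₗ Coalgebra.comul =
      TensorProduct.map LinearMap.id (coact (H := H) (A := A)).toLinearMap ∘ₗ l
  left_colinear :
    TensorProduct.map (HopfAlgebra.antipode ℂ) l ∘ₗ Coalgebra.comul =
      (TensorProduct.assoc ℂ H A A).toLinearMap ∘ₗ
        TensorProduct.map (TensorProduct.comm ℂ A H).toLinearMap LinearMap.id ∘ₗ
        TensorProduct.map (coact (H := H) (A := A)).toLinearMap LinearMap.id ∘ₗ l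

/-- `A` is a principal `H`-comodule algebra: the antipode of `H` is bijective and `A` admits a
strong connection. -/
def IsPrincipal : Prop :=
  Function.Bijective (HopfAlgebra.antipode ℂ : H →ₗ[ℂ] H) ∧
    ∃ l : H →ₗ[ℂ] A ⊗[ℂ] A, IsStrongConnection H A l

variable {H A} in
/-- A linear map `j : H → A` is right `H`-colinear: `ρ ∘ j = (j ⊗ id) ∘ Δ`. -/
def IsColinear (j : H →ₗ[ℂ] A) : Prop :=
  (coact (H := H) (A := A)).toLinearMap ∘ₗ j =
    TensorProduct.map j LinearMap.id ∘ₗ Coalgebra.comul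

/-- `A` is cleft: it is principal and has a cleaving map, that is, a unital, right `H`-colinear,
convolution invertible linear map `H → A`. -/
def IsCleft : Prop :=
  IsPrincipal H A ∧ ∃ j : H →ₗ[ℂ] A, j 1 = 1 ∧ IsColinear j ∧ IsConvInvertible j

/-- `A` is a trivial principal comodule algebra: it is principal and there is a right
`H`-colinear homomorphism of unital algebras `H → A`. -/
def IsTrivial : Prop :=
  IsPrincipal H A ∧ ∃ j : H →ₐ[ℂ] A, IsColinear j.toLinearMap

end Principal

end RightComoduleAlgebra

/-! ### Prolongations -/

section Prolongation

open RightComoduleAlgebra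

set_option linter.unusedSectionVars false

variable {H K : Type*} [Ring H] [Bialgebra ℂ H] [Ring K] [Bialgebra ℂ K]
  (A : Type*) [Ring A] [Algebra ℂ A] [RightComoduleAlgebra K A] (π : H →ₐc[ℂ] K)

/-- `a ⊗ h ↦ a₍₀₎ ⊗ a₍₁₎ ⊗ h`. -/
def cotensorLeft : A ⊗[ℂ] H →ₐ[ℂ] (A ⊗[ℂ] K) ⊗[ℂ] H :=
  Algebra.TensorProduct.map coact (AlgHom.id ℂ H)

/-- `a ⊗ h ↦ a ⊗ π(h₍₁₎) ⊗ h₍₂₎`. -/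
def cotensorRight : A ⊗[ℂ] H →ₐ[ℂ] (A ⊗[ℂ] K) ⊗[ℂ] H :=
  (Algebra.TensorProduct.assoc ℂ ℂ ℂ A K H).symm.toAlgHom.comp
    (Algebra.TensorProduct.map (AlgHom.id ℂ A)
      ((Algebra.TensorProduct.map (π : H →ₐ[ℂ] K) (AlgHom.id ℂ H)).comp
        (Bialgebra.comulAlgHom ℂ H)))

/-- The prolongation of a right `K`-comodule algebra `A` along a Hopf algebra map `π : H → K`, that
is, the cotensor product `A □_K H`, as a subalgebra of the tensor product algebra `A ⊗ H`. -/
def Prolongation : Subalgebra ℂ (A ⊗[ℂ] H) :=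
  AlgHom.equalizer (cotensorLeft (H := H) (K := K) A) (cotensorRight A π)

namespace Prolongation

/-- The map `id ⊗ Δ : A ⊗ H → (A ⊗ H) ⊗ H`. -/
def idComul (A H : Type*) [Ring H] [Bialgebra ℂ H] [Ring A] [Algebra ℂ A] :
    A ⊗[ℂ] H →ₐ[ℂ] (A ⊗[ℂ] H) ⊗[ℂ] H :=
  (Algebra.TensorProduct.assoc ℂ ℂ ℂ A H H).symm.toAlgHom.comp
    (Algebra.TensorProduct.map (AlgHom.id ℂ A) (Bialgebra.comulAlgHom ℂ H))

/-- The inclusion `(A □_K H) ⊗ H → (A ⊗ H) ⊗ H`. -/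
def incl : Prolongation A π ⊗[ℂ] H →ₐ[ℂ] (A ⊗[ℂ] H) ⊗[ℂ] H :=
  Algebra.TensorProduct.map (Prolongation A π).val (AlgHom.id ℂ H)

theorem incl_injective : Function.Injective (incl A π) :=
  Module.Flat.rTensor_preserves_injective_linearMap (M := H)
    (Prolongation A π).val.toLinearMap Subtype.val_injective

theorem mem_range_incl (y : (A ⊗[ℂ] H) ⊗[ℂ] H)
    (hy : Algebra.TensorProduct.map (cotensorLeft (H := H) (K := K) A) (AlgHom.id ℂ H) y =
      Algebra.TensorProduct.map (cotensorRight A π) (AlgHom.id ℂ H) y) :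
    y ∈ (incl A π).range := by
  have hex : Function.Exact (Prolongation A π).val.toLinearMap
      ((cotensorLeft (H := H) (K := K) A).toLinearMap - (cotensorRight A π).toLinearMap) := by
    intro x
    constructor
    · intro hx
      exact ⟨⟨x, sub_eq_zero.1 hx⟩, rfl⟩
    · rintro ⟨x, rfl⟩
      exact sub_eq_zero.2 x.2
  obtain ⟨x, hx⟩ := (Module.Flat.rTensor_exact H hex y).1 (by
    rw [LinearMap.rTensor_sub]
    exact sub_eq_zero.2 hy)
  exact ⟨x, hx⟩

theorem left_idComul :
    (Algebra.TensorProduct.map (cotensorLeft (H := H) (K := K) A) (AlgHom.id ℂ H)).comp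
        (idComul A H) =
      (idComul (A ⊗[ℂ] K) H).comp (cotensorLeft (H := H) (K := K) A) := by
  have key (a : A) (t : H ⊗[ℂ] H) :
      Algebra.TensorProduct.map (cotensorLeft (H := H) (K := K) A) (AlgHom.id ℂ H)
          ((Algebra.TensorProduct.assoc ℂ ℂ ℂ A H H).symm (a ⊗ₜ t)) =
        (Algebra.TensorProduct.assoc ℂ ℂ ℂ (A ⊗[ℂ] K) H H).symm (coact (H := K) a ⊗ₜ t) := by
    induction t with
    | zero => simp
    | tmul x y => simp [cotensorLeft]
    | add s t hs ht => simp only [TensorProduct.tmul_add, map_add, hs, ht]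
  refine Algebra.TensorProduct.ext' fun a h => ?_
  simpa [idComul, cotensorLeft] using key a (Coalgebra.comul h)

theorem right_idComul :
    (Algebra.TensorProduct.map (cotensorRight A π) (AlgHom.id ℂ H)).comp (idComul A H) =
      (idComul (A ⊗[ℂ] K) H).comp (cotensorRight A π) := by
  refine Algebra.TensorProduct.ext' fun a h => ?_
  let F : H ⊗[ℂ] (H ⊗[ℂ] H) →ₗ[ℂ] ((A ⊗[ℂ] K) ⊗[ℂ] H) ⊗[ℂ] H :=
    (TensorProduct.assoc ℂ (A ⊗[ℂ] K) H H).symm.toLinearMap ∘ₗ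
      TensorProduct.map (TensorProduct.mk ℂ A K a ∘ₗ (π : H →ₐ[ℂ] K).toLinearMap) LinearMap.id
  have k1 (s : H ⊗[ℂ] H) (y : H) :
      (Algebra.TensorProduct.assoc ℂ ℂ ℂ A K H).symm
          (a ⊗ₜ Algebra.TensorProduct.map (π : H →ₐ[ℂ] K) (AlgHom.id ℂ H) s) ⊗ₜ[ℂ] y =
        F (TensorProduct.assoc ℂ H H H (s ⊗ₜ y)) := by
    induction s with
    | zero => simp
    | tmul x y => simp [F]
    | add s t hs ht => simp only [TensorProduct.tmul_add, TensorProduct.add_tmul, map_add, hs, ht]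
  have k2 (t : H ⊗[ℂ] H) :
      Algebra.TensorProduct.map (cotensorRight A π) (AlgHom.id ℂ H)
          ((Algebra.TensorProduct.assoc ℂ ℂ ℂ A H H).symm (a ⊗ₜ t)) =
        F (TensorProduct.assoc ℂ H H H (Coalgebra.comul.rTensor H t)) := by
    induction t with
    | zero => simp
    | tmul x y => simpa [cotensorRight] using k1 (Coalgebra.comul x) y
    | add s t hs ht => simp only [TensorProduct.tmul_add, map_add, hs, ht]
  have k3 (t : H ⊗[ℂ] H) :
      idComul (A ⊗[ℂ] K) H ((Algebra.TensorProduct.assoc ℂ ℂ ℂ A K H).symm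
          (a ⊗ₜ Algebra.TensorProduct.map (π : H →ₐ[ℂ] K) (AlgHom.id ℂ H) t)) =
        F (Coalgebra.comul.lTensor H t) := by
    induction t with
    | zero => simp
    | tmul x y => simp [idComul, F]; rfl
    | add s t hs ht => simp only [TensorProduct.tmul_add, map_add, hs, ht]
  have h2 := k2 (Coalgebra.comul h)
  have h3 := k3 (Coalgebra.comul h)
  rw [Coalgebra.coassoc_apply, ← h3] at h2
  simpa [idComul, cotensorRight] using h2

theorem idComul_coassoc (y : A ⊗[ℂ] H) :
    Algebra.TensorProduct.assoc ℂ ℂ ℂ (A ⊗[ℂ] H) H H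
        (Algebra.TensorProduct.map (idComul A H) (AlgHom.id ℂ H) (idComul A H y)) =
      Algebra.TensorProduct.map (AlgHom.id ℂ (A ⊗[ℂ] H)) (Bialgebra.comulAlgHom ℂ H)
        (idComul A H y) := by
  induction y with
  | zero => simp
  | add s t hs ht => simp only [map_add, hs, ht]
  | tmul a h =>
    let F : H ⊗[ℂ] (H ⊗[ℂ] H) →ₗ[ℂ] (A ⊗[ℂ] H) ⊗[ℂ] (H ⊗[ℂ] H) :=
      TensorProduct.map (TensorProduct.mk ℂ A H a) LinearMap.id
    have k1 (s : H ⊗[ℂ] H) (y : H) :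
        Algebra.TensorProduct.assoc ℂ ℂ ℂ (A ⊗[ℂ] H) H H
            ((Algebra.TensorProduct.assoc ℂ ℂ ℂ A H H).symm (a ⊗ₜ s) ⊗ₜ[ℂ] y) =
          F (TensorProduct.assoc ℂ H H H (s ⊗ₜ y)) := by
      induction s with
      | zero => simp
      | tmul x y => simp [F]
      | add s t hs ht => simp only [TensorProduct.tmul_add, TensorProduct.add_tmul, map_add, hs, ht]
    have k2 (t : H ⊗[ℂ] H) :
        Algebra.TensorProduct.assoc ℂ ℂ ℂ (A ⊗[ℂ] H) H H
            (Algebra.TensorProduct.map (idComul A H) (AlgHom.id ℂ H)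
              ((Algebra.TensorProduct.assoc ℂ ℂ ℂ A H H).symm (a ⊗ₜ t))) =
          F (TensorProduct.assoc ℂ H H H (Coalgebra.comul.rTensor H t)) := by
      induction t with
      | zero => simp
      | tmul x y => simpa [idComul] using k1 (Coalgebra.comul x) y
      | add s t hs ht => simp only [TensorProduct.tmul_add, map_add, hs, ht]
    have k3 (t : H ⊗[ℂ] H) :
        Algebra.TensorProduct.map (AlgHom.id ℂ (A ⊗[ℂ] H)) (Bialgebra.comulAlgHom ℂ H)
            ((Algebra.TensorProduct.assoc ℂ ℂ ℂ A H H).symm (a ⊗ₜ t)) =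
          F (Coalgebra.comul.lTensor H t) := by
      induction t with
      | zero => simp
      | tmul x y => simp [F]
      | add s t hs ht => simp only [TensorProduct.tmul_add, map_add, hs, ht]
    have h2 := k2 (Coalgebra.comul h)
    have h3 := k3 (Coalgebra.comul h)
    rw [Coalgebra.coassoc_apply, ← h3] at h2
    simpa [idComul] using h2

theorem idComul_counit (y : A ⊗[ℂ] H) :
    Algebra.TensorProduct.rid ℂ ℂ (A ⊗[ℂ] H)
        (Algebra.TensorProduct.map (AlgHom.id ℂ (A ⊗[ℂ] H)) (Bialgebra.counitAlgHom ℂ H)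
          (idComul A H y)) = y := by
  induction y with
  | zero => simp
  | add s t hs ht => simp only [map_add, hs, ht]
  | tmul a h =>
    have k (t : H ⊗[ℂ] H) :
        Algebra.TensorProduct.rid ℂ ℂ (A ⊗[ℂ] H)
            (Algebra.TensorProduct.map (AlgHom.id ℂ (A ⊗[ℂ] H)) (Bialgebra.counitAlgHom ℂ H)
              ((Algebra.TensorProduct.assoc ℂ ℂ ℂ A H H).symm (a ⊗ₜ t))) =
          a ⊗ₜ TensorProduct.rid ℂ H (Coalgebra.counit.lTensor H t) := by
      induction t with
      | zero => simp
      | tmul x y => simp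
      | add s t hs ht => simp only [TensorProduct.tmul_add, map_add, hs, ht]
    have := k (Coalgebra.comul h)
    rw [Coalgebra.lTensor_counit_comul] at this
    simpa [idComul] using this

theorem idComul_mem (x : Prolongation A π) : idComul A H x ∈ (incl A π).range := by
  refine mem_range_incl A π _ ?_
  have h : cotensorLeft (H := H) (K := K) A (x : A ⊗[ℂ] H) = cotensorRight A π x := x.2
  exact (DFunLike.congr_fun (left_idComul (H := H) (K := K) A) (x : A ⊗[ℂ] H)).trans
    ((congrArg (idComul (A ⊗[ℂ] K) H) h).trans
      (DFunLike.congr_fun (right_idComul A π) (x : A ⊗[ℂ] H)).symm)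

/-- The restriction of `id ⊗ Δ` to `A □_K H → (A □_K H) ⊗ H`. -/
def coaction : Prolongation A π →ₐ[ℂ] Prolongation A π ⊗[ℂ] H :=
  (AlgEquiv.ofInjective (incl A π) (incl_injective A π)).symm.toAlgHom.comp
    (((idComul A H).comp (Prolongation A π).val).codRestrict (incl A π).range
      (idComul_mem A π))

theorem incl_coaction (x : Prolongation A π) : incl A π (coaction A π x) = idComul A H x :=
  congrArg Subtype.val ((AlgEquiv.ofInjective (incl A π) (incl_injective A π)).apply_symm_apply
    (((idComul A H).comp (Prolongation A π).val).codRestrict (incl A π).range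
      (idComul_mem A π) x))

theorem coaction_coassoc (x : Prolongation A π) :
    Algebra.TensorProduct.assoc ℂ ℂ ℂ (Prolongation A π) H H
        (Algebra.TensorProduct.map (coaction A π) (AlgHom.id ℂ H) (coaction A π x)) =
      Algebra.TensorProduct.map (AlgHom.id ℂ (Prolongation A π)) (Bialgebra.comulAlgHom ℂ H)
        (coaction A π x) := by
  refine Module.Flat.rTensor_preserves_injective_linearMap (M := H ⊗[ℂ] H)
    (Prolongation A π).val.toLinearMap Subtype.val_injective ?_
  have k0 (t : Prolongation A π ⊗[ℂ] H) (y : H) :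
      (Prolongation A π).val.toLinearMap.rTensor (H ⊗[ℂ] H)
          (Algebra.TensorProduct.assoc ℂ ℂ ℂ (Prolongation A π) H H (t ⊗ₜ y)) =
        Algebra.TensorProduct.assoc ℂ ℂ ℂ (A ⊗[ℂ] H) H H (incl A π t ⊗ₜ y) := by
    induction t with
    | zero => simp
    | tmul x y => simp [incl]
    | add s t hs ht => simp only [TensorProduct.add_tmul, map_add, hs, ht]
  have k1 (t : Prolongation A π ⊗[ℂ] H) :
      (Prolongation A π).val.toLinearMap.rTensor (H ⊗[ℂ] H)
          (Algebra.TensorProduct.assoc ℂ ℂ ℂ (Prolongation A π) H H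
            (Algebra.TensorProduct.map (coaction A π) (AlgHom.id ℂ H) t)) =
        Algebra.TensorProduct.assoc ℂ ℂ ℂ (A ⊗[ℂ] H) H H
          (Algebra.TensorProduct.map (idComul A H) (AlgHom.id ℂ H) (incl A π t)) := by
    induction t with
    | zero => simp
    | tmul x y =>
      rw [Algebra.TensorProduct.map_tmul, k0, incl_coaction]
      simp [incl]
    | add s t hs ht => simp only [map_add, hs, ht]
  have k2 (t : Prolongation A π ⊗[ℂ] H) :
      (Prolongation A π).val.toLinearMap.rTensor (H ⊗[ℂ] H)
          (Algebra.TensorProduct.map (AlgHom.id ℂ (Prolongation A π))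
            (Bialgebra.comulAlgHom ℂ H) t) =
        Algebra.TensorProduct.map (AlgHom.id ℂ (A ⊗[ℂ] H)) (Bialgebra.comulAlgHom ℂ H)
          (incl A π t) := by
    induction t with
    | zero => simp
    | tmul x y => simp [incl]
    | add s t hs ht => simp only [map_add, hs, ht]
  rw [k1, k2, incl_coaction, idComul_coassoc]

theorem coaction_counit (x : Prolongation A π) :
    Algebra.TensorProduct.rid ℂ ℂ (Prolongation A π)
        (Algebra.TensorProduct.map (AlgHom.id ℂ (Prolongation A π)) (Bialgebra.counitAlgHom ℂ H)
          (coaction A π x)) = x := by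
  have k (t : Prolongation A π ⊗[ℂ] H) :
      (Prolongation A π).val (Algebra.TensorProduct.rid ℂ ℂ (Prolongation A π)
          (Algebra.TensorProduct.map (AlgHom.id ℂ (Prolongation A π))
            (Bialgebra.counitAlgHom ℂ H) t)) =
        Algebra.TensorProduct.rid ℂ ℂ (A ⊗[ℂ] H)
          (Algebra.TensorProduct.map (AlgHom.id ℂ (A ⊗[ℂ] H)) (Bialgebra.counitAlgHom ℂ H)
            (incl A π t)) := by
    induction t with
    | zero => simp
    | tmul x y => simp [incl]
    | add s t hs ht => simp only [map_add, hs, ht]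
  apply Subtype.val_injective
  have := k (coaction A π x)
  rw [incl_coaction, idComul_counit] at this
  exact this

/-- The prolongation is a right `H`-comodule algebra through the restriction of `id ⊗ Δ`. -/
instance : RightComoduleAlgebra H (Prolongation A π) where
  coact := coaction A π
  coassoc := AlgHom.ext (coaction_coassoc A π)
  counit := AlgHom.ext (coaction_counit A π)

end Prolongation

end Prolongation

/-! ### Quantum spheres -/

/-- The Hopf algebra `O(ℤ/2)`: the group algebra of `ℤ/2`, with grouplike generator `u`,
`u ^ 2 = 1`. -/
abbrev OZ2 : Type := AddMonoidAlgebra ℂ (ZMod 2)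

/-- The generator `u` of `O(ℤ/2)`. -/
def OZ2.u : OZ2 := AddMonoidAlgebra.single 1 1

/-- The Hopf algebra `O(U(1))`: Laurent polynomials in a grouplike `v`. -/
abbrev OU1 : Type := LaurentPolynomial ℂ

/-- The Hopf algebra map `O(U(1)) → O(ℤ/2)`, `v ↦ u`. -/
def piTwo : OU1 →ₐc[ℂ] OZ2 :=
  AddMonoidAlgebra.mapDomainBialgHom ℂ (Int.castAddHom (ZMod 2))

theorem piTwo_T : piTwo (LaurentPolynomial.T 1) = OZ2.u := by
  simp [piTwo, LaurentPolynomial.T, OZ2.u, -LaurentPolynomial.single_eq_C_mul_T]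

theorem OZ2.u_mul_u : OZ2.u * OZ2.u = 1 := by
  rw [OZ2.u, AddMonoidAlgebra.single_mul_single, AddMonoidAlgebra.one_def, one_mul]
  rfl

theorem OZ2.comul_u : Coalgebra.comul (R := ℂ) OZ2.u = OZ2.u ⊗ₜ[ℂ] OZ2.u := by
  simp [OZ2.u]

theorem OZ2.counit_u : Coalgebra.counit (R := ℂ) OZ2.u = 1 := by
  simp [OZ2.u]

/-- The free algebra on symbols `z_0, …, z_n` and `z_0^*, …, z_n^*`, where `m = 2n` or
`m = 2n + 1`. -/
abbrev QSphereFree (m : ℕ) : Type := FreeAlgebra ℂ (Fin (m / 2 + 1) ⊕ Fin (m / 2 + 1))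

/-- The symbol `z_i`. -/
def QSphereFree.z {m : ℕ} (i : Fin (m / 2 + 1)) : QSphereFree m := FreeAlgebra.ι ℂ (Sum.inl i)

/-- The symbol `z_i^*`. -/
def QSphereFree.zs {m : ℕ} (i : Fin (m / 2 + 1)) : QSphereFree m := FreeAlgebra.ι ℂ (Sum.inr i)

open QSphereFree in
/-- The defining relations of the quantum sphere, together with the adjoint of the first one (the
adjoint of each of the others is again a relation of the list). The last relation is imposed for
even `m` only. -/
inductive QSphereRel (q : ℝ) (m : ℕ) : QSphereFree m → QSphereFree m → Prop
  | z_mul_z (i j : Fin (m / 2 + 1)) (h : i < j) :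
      QSphereRel q m (z i * z j) ((q : ℂ) • (z j * z i))
  | zs_mul_zs (i j : Fin (m / 2 + 1)) (h : i < j) :
      QSphereRel q m (zs j * zs i) ((q : ℂ) • (zs i * zs j))
  | z_mul_zs (i j : Fin (m / 2 + 1)) (h : i ≠ j) :
      QSphereRel q m (z i * zs j) ((q : ℂ) • (zs j * z i))
  | z_mul_zs_self (i : Fin (m / 2 + 1)) :
      QSphereRel q m (z i * zs i)
        (zs i * z i + ((q : ℂ) ^ (-2 : ℤ) - 1) • ∑ k ∈ Finset.Ioi i, z k * zs k)
  | radius : QSphereRel q m (∑ k, z k * zs k) 1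
  | self_adjoint (h : Even m) : QSphereRel q m (zs (Fin.last (m / 2))) (z (Fin.last (m / 2)))

/-- The coordinate algebra `O(S^m_q)` of the quantum sphere. -/
def QSphere (q : ℝ) (m : ℕ) : Type := RingQuot (QSphereRel q m)

namespace QSphere

variable (q : ℝ) (m : ℕ)

instance : Ring (QSphere q m) := inferInstanceAs (Ring (RingQuot (QSphereRel q m)))

instance : Algebra ℂ (QSphere q m) := inferInstanceAs (Algebra ℂ (RingQuot (QSphereRel q m)))

/-- The quotient map from the free algebra. -/
def mk : QSphereFree m →ₐ[ℂ] QSphere q m := RingQuot.mkAlgHom ℂ (QSphereRel q m)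

variable {q m}

theorem mk_surjective : Function.Surjective (mk q m) := RingQuot.mkAlgHom_surjective ℂ _

theorem mk_rel {x y : QSphereFree m} (h : QSphereRel q m x y) : mk q m x = mk q m y :=
  RingQuot.mkAlgHom_rel ℂ h

/-- The generator `z_i` of `O(S^m_q)`. -/
def z (i : Fin (m / 2 + 1)) : QSphere q m := mk q m (QSphereFree.z i)

/-- The generator `z_i^*` of `O(S^m_q)`. -/
def zs (i : Fin (m / 2 + 1)) : QSphere q m := mk q m (QSphereFree.zs i)

theorem z_mul_z {i j : Fin (m / 2 + 1)} (h : i < j) :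
    (z i * z j : QSphere q m) = (q : ℂ) • (z j * z i) := by
  simpa [z, zs, -Complex.coe_smul] using mk_rel (q := q) (.z_mul_z i j h)

theorem zs_mul_zs {i j : Fin (m / 2 + 1)} (h : i < j) :
    (zs j * zs i : QSphere q m) = (q : ℂ) • (zs i * zs j) := by
  simpa [z, zs, -Complex.coe_smul] using mk_rel (q := q) (.zs_mul_zs i j h)

theorem z_mul_zs {i j : Fin (m / 2 + 1)} (h : i ≠ j) :
    (z i * zs j : QSphere q m) = (q : ℂ) • (zs j * z i) := by
  simpa [z, zs, -Complex.coe_smul] using mk_rel (q := q) (.z_mul_zs i j h)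

theorem z_mul_zs_self (i : Fin (m / 2 + 1)) :
    (z i * zs i : QSphere q m) =
      zs i * z i + ((q : ℂ) ^ (-2 : ℤ) - 1) • ∑ k ∈ Finset.Ioi i, z k * zs k := by
  simpa [z, zs, -Complex.coe_smul] using mk_rel (q := q) (.z_mul_zs_self i)

theorem radius : (∑ k, z k * zs k : QSphere q m) = 1 := by
  simpa [z, zs, -Complex.coe_smul] using mk_rel (q := q) (m := m) .radius

theorem zs_last (h : Even m) :
    (zs (Fin.last (m / 2)) : QSphere q m) = z (Fin.last (m / 2)) :=
  mk_rel (.self_adjoint h)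

/-- The universal property of `O(S^m_q)`: elements `x_i`, `y_i` of a complex algebra which satisfy
the defining relations determine an algebra map with `z_i ↦ x_i`, `z_i^* ↦ y_i`. -/
def lift {B : Type*} [Ring B] [Algebra ℂ B] (x y : Fin (m / 2 + 1) → B)
    (h₁ : ∀ i j, i < j → x i * x j = (q : ℂ) • (x j * x i))
    (h₂ : ∀ i j, i < j → y j * y i = (q : ℂ) • (y i * y j))
    (h₃ : ∀ i j, i ≠ j → x i * y j = (q : ℂ) • (y j * x i))
    (h₄ : ∀ i, x i * y i =
      y i * x i + ((q : ℂ) ^ (-2 : ℤ) - 1) • ∑ k ∈ Finset.Ioi i, x k * y k)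
    (h₅ : ∑ k, x k * y k = 1)
    (h₆ : Even m → y (Fin.last (m / 2)) = x (Fin.last (m / 2))) :
    QSphere q m →ₐ[ℂ] B :=
  RingQuot.liftAlgHom ℂ ⟨FreeAlgebra.lift ℂ (Sum.elim x y), by
    intro a b hab
    cases hab with
    | z_mul_z i j h => simpa [QSphereFree.z, QSphereFree.zs, -Complex.coe_smul] using h₁ i j h
    | zs_mul_zs i j h => simpa [QSphereFree.z, QSphereFree.zs, -Complex.coe_smul] using h₂ i j h
    | z_mul_zs i j h => simpa [QSphereFree.z, QSphereFree.zs, -Complex.coe_smul] using h₃ i j h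
    | z_mul_zs_self i => simpa [QSphereFree.z, QSphereFree.zs, -Complex.coe_smul] using h₄ i
    | radius => simpa [QSphereFree.z, QSphereFree.zs, -Complex.coe_smul] using h₅
    | self_adjoint h => simpa [QSphereFree.z, QSphereFree.zs, -Complex.coe_smul] using h₆ h⟩

section lift

variable {B : Type*} [Ring B] [Algebra ℂ B] (x y : Fin (m / 2 + 1) → B)
  (h₁ : ∀ i j, i < j → x i * x j = (q : ℂ) • (x j * x i))
  (h₂ : ∀ i j, i < j → y j * y i = (q : ℂ) • (y i * y j))
  (h₃ : ∀ i j, i ≠ j → x i * y j = (q : ℂ) • (y j * x i))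
  (h₄ : ∀ i, x i * y i =
    y i * x i + ((q : ℂ) ^ (-2 : ℤ) - 1) • ∑ k ∈ Finset.Ioi i, x k * y k)
  (h₅ : ∑ k, x k * y k = 1)
  (h₆ : Even m → y (Fin.last (m / 2)) = x (Fin.last (m / 2)))

theorem lift_z (i : Fin (m / 2 + 1)) : lift x y h₁ h₂ h₃ h₄ h₅ h₆ (z i) = x i := by
  refine (RingQuot.liftAlgHom_mkAlgHom_apply _ _ _ _).trans ?_
  simp [QSphereFree.z]

theorem lift_zs (i : Fin (m / 2 + 1)) : lift x y h₁ h₂ h₃ h₄ h₅ h₆ (zs i) = y i := by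
  refine (RingQuot.liftAlgHom_mkAlgHom_apply _ _ _ _).trans ?_
  simp [QSphereFree.zs]

end lift

theorem algHom_ext {B : Type*} [Ring B] [Algebra ℂ B] {f g : QSphere q m →ₐ[ℂ] B}
    (h : ∀ i, f (z i) = g (z i)) (hs : ∀ i, f (zs i) = g (zs i)) : f = g := by
  refine RingQuot.ringQuot_ext' ℂ f g (FreeAlgebra.hom_ext ?_)
  funext k
  cases k with
  | inl i => exact h i
  | inr i => exact hs i

/-- The opposite algebra with complex conjugate scalar multiplication. Algebra maps into it are
antilinear antimultiplicative maps. -/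
def ConjOp (B : Type*) : Type _ := Bᵐᵒᵖ

section ConjOp

variable {B : Type*} [Ring B]

instance : Ring (ConjOp B) := inferInstanceAs (Ring Bᵐᵒᵖ)

/-- The identity map, from `B` to its conjugate opposite algebra. -/
def ConjOp.op : B ≃+ ConjOp B := MulOpposite.opAddEquiv

theorem ConjOp.op_mul (a b : B) : ConjOp.op (a * b) = ConjOp.op b * ConjOp.op a := rfl

theorem ConjOp.op_one : ConjOp.op (1 : B) = 1 := rfl

variable [Algebra ℂ B]

instance : Algebra ℂ (ConjOp B) :=
  ((algebraMap ℂ Bᵐᵒᵖ).comp (starRingEnd ℂ)).toAlgebra' fun c x =>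
    Algebra.commutes (A := Bᵐᵒᵖ) (starRingEnd ℂ c) x

theorem ConjOp.algebraMap_eq (c : ℂ) :
    algebraMap ℂ (ConjOp B) c = ConjOp.op (algebraMap ℂ B (starRingEnd ℂ c)) := rfl

theorem ConjOp.op_smul (c : ℂ) (b : B) :
    ConjOp.op (c • b) = starRingEnd ℂ c • ConjOp.op b := by
  rw [Algebra.smul_def, Algebra.smul_def, ConjOp.algebraMap_eq, Complex.conj_conj,
    ← ConjOp.op_mul, Algebra.commutes]

end ConjOp

variable (q m) in
/-- The adjoint, as an algebra map into the conjugate opposite algebra. -/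
def starHom : QSphere q m →ₐ[ℂ] ConjOp (QSphere q m) :=
  lift (fun i => ConjOp.op (zs i)) (fun i => ConjOp.op (z i))
    (fun i j h => by
      rw [← ConjOp.op_mul, zs_mul_zs h, ConjOp.op_smul, ConjOp.op_mul, Complex.conj_ofReal])
    (fun i j h => by
      rw [← ConjOp.op_mul, z_mul_z h, ConjOp.op_smul, ConjOp.op_mul, Complex.conj_ofReal])
    (fun i j h => by
      rw [← ConjOp.op_mul, z_mul_zs h.symm, ConjOp.op_smul, ConjOp.op_mul, Complex.conj_ofReal])
    (fun i => by
      simp only [← ConjOp.op_mul]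
      rw [z_mul_zs_self i, map_add, ConjOp.op_smul, map_sum]
      simp)
    (by
      simp only [← ConjOp.op_mul]
      rw [← map_sum, radius, ConjOp.op_one])
    (fun h => by rw [zs_last h])

theorem starHom_z (i : Fin (m / 2 + 1)) : starHom q m (z i) = ConjOp.op (zs i) := by
  rw [starHom, lift_z]

theorem starHom_zs (i : Fin (m / 2 + 1)) : starHom q m (zs i) = ConjOp.op (z i) := by
  rw [starHom, lift_zs]

/-- The antilinear antimultiplicative involution exchanging `z_i` and `z_i^*`. -/
instance : StarRing (QSphere q m) where
  star x := ConjOp.op.symm (starHom q m x)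
  star_involutive x := by
    let f : QSphere q m →ₐ[ℂ] QSphere q m :=
      { toFun := fun x => ConjOp.op.symm (starHom q m (ConjOp.op.symm (starHom q m x)))
        map_one' := by
          rw [map_one, ← ConjOp.op_one, AddEquiv.symm_apply_apply, map_one, ← ConjOp.op_one,
            AddEquiv.symm_apply_apply]
        map_mul' := fun x y => by
          have h (a b : QSphere q m) : ConjOp.op.symm (starHom q m (a * b)) =
              ConjOp.op.symm (starHom q m b) * ConjOp.op.symm (starHom q m a) := by
            rw [map_mul]; rfl
          rw [h, h]
        map_zero' := by simp
        map_add' := fun x y => by simp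
        commutes' := fun c => by
          simp [ConjOp.algebraMap_eq] }
    have hf : f = AlgHom.id ℂ _ := by
      refine algHom_ext (fun i => ?_) (fun i => ?_)
      · change ConjOp.op.symm (starHom q m (ConjOp.op.symm (starHom q m (z i)))) = z i
        rw [starHom_z, AddEquiv.symm_apply_apply, starHom_zs, AddEquiv.symm_apply_apply]
      · change ConjOp.op.symm (starHom q m (ConjOp.op.symm (starHom q m (zs i)))) = zs i
        rw [starHom_zs, AddEquiv.symm_apply_apply, starHom_z, AddEquiv.symm_apply_apply]
    exact DFunLike.congr_fun hf x
  star_mul x y := by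
    rw [map_mul]; rfl
  star_add x y := by
    rw [map_add, map_add]

instance : StarModule ℂ (QSphere q m) where
  star_smul c x := by
    change ConjOp.op.symm (starHom q m (c • x)) = starRingEnd ℂ c • ConjOp.op.symm (starHom q m x)
    rw [map_smul, AddEquiv.symm_apply_eq, ConjOp.op_smul, Complex.conj_conj,
      AddEquiv.apply_symm_apply]

theorem star_z (i : Fin (m / 2 + 1)) : star (z i : QSphere q m) = zs i := by
  change ConjOp.op.symm (starHom q m (z i)) = zs i
  rw [starHom_z, AddEquiv.symm_apply_apply]

variable (q m)

variable {q m} in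
theorem tmul_u_mul_tmul_u (a b : QSphere q m) :
    (a ⊗ₜ[ℂ] OZ2.u) * (b ⊗ₜ[ℂ] OZ2.u) = (a * b) ⊗ₜ[ℂ] 1 := by
  rw [Algebra.TensorProduct.tmul_mul_tmul, OZ2.u_mul_u]

/-- The coaction `z_i ↦ z_i ⊗ u`, `z_i^* ↦ z_i^* ⊗ u` of `O(ℤ/2)` on `O(S^m_q)`. -/
def coaction : QSphere q m →ₐ[ℂ] QSphere q m ⊗[ℂ] OZ2 :=
  lift (fun i => z i ⊗ₜ OZ2.u) (fun i => zs i ⊗ₜ OZ2.u)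
    (fun i j h => by
      rw [tmul_u_mul_tmul_u, tmul_u_mul_tmul_u, z_mul_z h, TensorProduct.smul_tmul'])
    (fun i j h => by
      rw [tmul_u_mul_tmul_u, tmul_u_mul_tmul_u, zs_mul_zs h, TensorProduct.smul_tmul'])
    (fun i j h => by
      rw [tmul_u_mul_tmul_u, tmul_u_mul_tmul_u, z_mul_zs h, TensorProduct.smul_tmul'])
    (fun i => by
      simp only [tmul_u_mul_tmul_u]
      rw [← TensorProduct.sum_tmul, TensorProduct.smul_tmul', ← TensorProduct.add_tmul,
        ← z_mul_zs_self])
    (by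
      simp only [tmul_u_mul_tmul_u]
      rw [← TensorProduct.sum_tmul, radius, Algebra.TensorProduct.one_def])
    (fun h => by rw [zs_last h])

variable {q m} in
theorem coaction_z (i : Fin (m / 2 + 1)) : coaction q m (z i) = z i ⊗ₜ OZ2.u := by
  rw [coaction, lift_z]

variable {q m} in
theorem coaction_zs (i : Fin (m / 2 + 1)) : coaction q m (zs i) = zs i ⊗ₜ OZ2.u := by
  rw [coaction, lift_zs]

instance : RightComoduleAlgebra OZ2 (QSphere q m) where
  coact := coaction q m
  coassoc := by
    refine algHom_ext (fun i => ?_) (fun i => ?_)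
    · simp [coaction_z, OZ2.comul_u]
    · simp [coaction_zs, OZ2.comul_u]
  counit := by
    refine algHom_ext (fun i => ?_) (fun i => ?_)
    · simp [coaction_z, OZ2.counit_u]
    · simp [coaction_zs, OZ2.counit_u]

end QSphere

end

/-!
Write `A = O(S^m_q)`. The coaction of `O(U(1)) = ℂ[v, v⁻¹]` on the prolongation is a `ℤ`-grading,
and the component of degree `n` is `A_ε ⊗ v^n`, where `A_ε` is the even or the odd part of `A`
according to the parity of `n`.

*Principality.* The sphere relation `∑ z_k z_k^* = 1` for odd `n`, and `1 * 1 = 1` for even `n`,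
write the unit as a sum of products of elements of degrees `-n` and `n`. These sums, read in the
tensor square, are the values of a strong connection at `v^n`
(`RightComoduleAlgebra.isPrincipal_of_sum_mul_eq_one`).

*No cleaving map.* A colinear map sends `v` to some `a ⊗ v` with `a` odd, and if it is convolution
invertible or multiplicative, then `a` is a unit of `A`. But `A` has no odd units when `1 < m`
(`QSphere.not_isUnit_of_coaction_eq_tmul_u`). To see this, send `A` to its quotient `O(S^2_q)`, and
represent that algebra by `q`-difference operators `∑ k, f_k(s) * φ(q ^ k * s)` (`QSphere.rep`).
The extremal degrees `k` of such operators add up under composition, because polynomials have no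
zero divisors; hence a unit acts by a single term `f(s) * φ(q ^ K * s)`, and its inverse by a term
of degree `-K` (`qDiff.exists_eq_single`).
* `K ≠ 0` is impossible: one of the two operators would carry the value at `s = 1` to
  `s = q ^ |K|`, but the functions vanishing at `q, q ^ 2, …` form an invariant subspace
  (`QSphere.rep_apply_eq_zero`). This replaces the Fredholm index of the quantum disc.
* `K = 0` is impossible for an odd unit: `f` is then an odd polynomial
  (`QSphere.rep_signHom`), so that `f(0) = 0`, whereas `f` is invertible.
-/

noncomputable section

/-! ### Algebraic `q`-difference operators -/

open Polynomial in
/-- The operator `φ(s, w) ↦ w ^ k * p(s) * φ(q ^ k * s, w)`, depending linearly on `p`. The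
variable `w` records the parity of `k`, as `(-w) ^ k = (-1) ^ k * w ^ k`. -/
def qDiff (q : ℂ) (k : ℤ) : ℂ[X] →ₗ[ℂ] Module.End ℂ (ℂ × ℂˣ → ℂ) where
  toFun p :=
    { toFun := fun φ x => (x.2 : ℂ) ^ k * p.eval x.1 * φ (q ^ k * x.1, x.2)
      map_add' := fun φ ψ => by ext x; simp only [Pi.add_apply]; ring
      map_smul' := fun c φ => by
        ext x; simp only [Pi.smul_apply, smul_eq_mul, RingHom.id_apply]; ring }
  map_add' p r := by
    ext φ x
    simp only [LinearMap.coe_mk, AddHom.coe_mk, LinearMap.add_apply, Pi.add_apply, eval_add]; ring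
  map_smul' c p := by
    ext φ x
    simp only [LinearMap.coe_mk, AddHom.coe_mk, LinearMap.smul_apply, Pi.smul_apply, eval_smul,
      smul_eq_mul, RingHom.id_apply]
    ring

namespace qDiff

open Polynomial

variable {q : ℂ}

theorem apply (k : ℤ) (p : ℂ[X]) (φ : ℂ × ℂˣ → ℂ) (s : ℂ) (w : ℂˣ) :
    qDiff q k p φ (s, w) = (w : ℂ) ^ k * p.eval s * φ (q ^ k * s, w) := rfl

theorem mul (hq : q ≠ 0) (k l : ℤ) (p r : ℂ[X]) :
    qDiff q k p * qDiff q l r = qDiff q (k + l) (p * r.comp (C (q ^ k) * X)) := by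
  ext φ ⟨s, w⟩
  simp only [Module.End.mul_apply, apply, eval_mul, eval_comp, eval_C, eval_X,
    zpow_add₀ w.ne_zero, zpow_add₀ hq]
  rw [show q ^ l * (q ^ k * s) = q ^ k * q ^ l * s by ring]
  ring

theorem zero_one : qDiff q 0 1 = 1 := by
  ext φ ⟨s, w⟩
  simp [apply]

variable (q) in
/-- The `q`-difference operator with symbol `f`, that is, `∑ k, qDiff q k (f k)`. -/
def op : (ℤ →₀ ℂ[X]) →ₗ[ℂ] Module.End ℂ (ℂ × ℂˣ → ℂ) := Finsupp.lsum ℂ (qDiff q)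

theorem op_single (k : ℤ) (p : ℂ[X]) : op q (Finsupp.single k p) = qDiff q k p := by
  simp [op]

theorem op_apply (f : ℤ →₀ ℂ[X]) (φ : ℂ × ℂˣ → ℂ) (s : ℂ) (w : ℂˣ) :
    op q f φ (s, w) = ∑ k ∈ f.support, (w : ℂ) ^ k * (f k).eval s * φ (q ^ k * s, w) := by
  simp [op, Finsupp.lsum_apply, Finsupp.sum, LinearMap.sum_apply, Finset.sum_apply, apply]

theorem op_mul_mem (hq : q ≠ 0) {S T : Module.End ℂ (ℂ × ℂˣ → ℂ)}
    (hS : S ∈ LinearMap.range (op q)) (hT : T ∈ LinearMap.range (op q)) :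
    S * T ∈ LinearMap.range (op q) := by
  obtain ⟨f, rfl⟩ := hS
  obtain ⟨g, rfl⟩ := hT
  induction f using Finsupp.induction_linear with
  | zero => simp
  | add f₁ f₂ h₁ h₂ => rw [map_add, add_mul]; exact add_mem h₁ h₂
  | single k p =>
    induction g using Finsupp.induction_linear with
    | zero => simp
    | add g₁ g₂ h₁ h₂ => rw [map_add, mul_add]; exact add_mem h₁ h₂
    | single l r =>
      rw [op_single, op_single, mul hq, ← op_single]
      exact LinearMap.mem_range_self _ _

/-- If `op f * op g = 1` and the degree `K + L` is attained only once by sums of degrees of `f` and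
`g`, then that degree is zero: the corresponding coefficient `f_K(s) * g_L(q ^ K * s)` of the
product is not the zero polynomial. -/
theorem add_eq_zero_of_op_mul_eq_one {q : ℝ} (hq0 : 0 < q) (hq1 : q < 1) {f g : ℤ →₀ ℂ[X]}
    (h : op q f * op q g = 1) {K L : ℤ} (hK : K ∈ f.support) (hL : L ∈ g.support)
    (hu : UniqueAdd f.support g.support K L) : K + L = 0 := by
  have hq : (q : ℂ) ≠ 0 := by exact_mod_cast hq0.ne'
  have hp : X * f K * (g L).comp (C ((q : ℂ) ^ K) * X) ≠ 0 := by
    refine mul_ne_zero (mul_ne_zero X_ne_zero (Finsupp.mem_support_iff.1 hK)) fun h0 => ?_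
    have := congrArg (fun r => r.comp (C ((q : ℂ) ^ (-K)) * X)) h0
    simp only [comp_assoc, mul_comp, C_comp, X_comp, zero_comp] at this
    rw [← mul_assoc, ← C_mul, ← zpow_add₀ hq] at this
    simp only [add_neg_cancel, zpow_zero, map_one, one_mul, comp_X] at this
    exact Finsupp.mem_support_iff.1 hL this
  obtain ⟨s, hs⟩ : ∃ s, (X * f K * (g L).comp (C ((q : ℂ) ^ K) * X)).eval s ≠ 0 := by
    by_contra! hc
    exact hp (Polynomial.funext fun s => by simp [hc s])
  simp only [eval_mul, eval_X, eval_comp, eval_C, ne_eq, mul_eq_zero, not_or] at hs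
  obtain ⟨⟨hs0, hfs⟩, hgs⟩ := hs
  have hinj (i j : ℤ) (hij : (q : ℂ) ^ i * s = (q : ℂ) ^ j * s) : i = j := by
    have := mul_right_cancel₀ hs0 hij
    exact zpow_right_injective₀ hq0 hq1.ne (by exact_mod_cast this)
  -- the characteristic function of the point reached in degree `K + L`
  let φ : ℂ × ℂˣ → ℂ := fun x => if x.1 = (q : ℂ) ^ (K + L) * s then 1 else 0
  have h1 : (op (q : ℂ) f * op (q : ℂ) g) φ (s, 1) = φ (s, 1) := by rw [h]; rfl
  have key (k l : ℤ) (hne : k + l ≠ K + L) :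
      φ ((q : ℂ) ^ l * ((q : ℂ) ^ k * s), 1) = 0 := by
    refine if_neg fun hc => hne (hinj _ _ ?_)
    rw [← hc, zpow_add₀ hq]; ring
  rw [Module.End.mul_apply, op_apply, Finset.sum_eq_single K, op_apply,
    Finset.sum_eq_single L] at h1
  · by_contra hne
    rw [show φ (s, 1) = 0 from if_neg fun hc => hne (hinj (K + L) 0 (by simp [← hc]))] at h1
    rw [show φ ((q : ℂ) ^ L * ((q : ℂ) ^ K * s), 1) = 1 from
      if_pos (by rw [zpow_add₀ hq]; ring)] at h1
    simp [hfs, hgs] at h1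
  · intro l hl hlL
    rw [key K l (by omega), mul_zero]
  · exact fun hc => absurd hL hc
  · intro k hk hkK
    rw [op_apply, Finset.sum_eq_zero, mul_zero]
    intro l hl
    rw [key k l (fun hc => hkK (hu hk hl hc).1), mul_zero]
  · exact fun hc => absurd hK hc

/-- An invertible `q`-difference operator is a single term, since the largest degrees of the
operator and of its inverse cancel, and so do the smallest ones. -/
theorem exists_eq_single {q : ℝ} (hq0 : 0 < q) (hq1 : q < 1) {f g : ℤ →₀ ℂ[X]}
    (h : op q f * op q g = 1) :
    ∃ (K : ℤ) (p r : ℂ[X]), op q f = qDiff q K p ∧ op q g = qDiff q (-K) r := by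
  have hf : f.support.Nonempty := by
    rw [Finsupp.support_nonempty_iff]; rintro rfl; simp at h
  have hg : g.support.Nonempty := by
    rw [Finsupp.support_nonempty_iff]; rintro rfl; simp at h
  have hmax := add_eq_zero_of_op_mul_eq_one hq0 hq1 h (f.support.max'_mem hf)
    (g.support.max'_mem hg) fun k l hk hl hkl => by
      have := f.support.le_max' k hk
      have := g.support.le_max' l hl
      omega
  have hmin := add_eq_zero_of_op_mul_eq_one hq0 hq1 h (f.support.min'_mem hf)
    (g.support.min'_mem hg) fun k l hk hl hkl => by
      have := f.support.min'_le k hk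
      have := g.support.min'_le l hl
      omega
  have h₁ := f.support.min'_le _ (f.support.max'_mem hf)
  have h₂ := g.support.min'_le _ (g.support.max'_mem hg)
  set K := f.support.max' hf with hK
  refine ⟨K, f K, g (-K), ?_, ?_⟩
  · rw [← op_single]
    congr 1
    ext1 k
    rw [Finsupp.single_apply]
    split_ifs with hk
    · rw [hk]
    · by_contra hc
      have hk' := Finsupp.mem_support_iff.2 hc
      have := f.support.le_max' k hk'
      have := f.support.min'_le k hk'
      omega
  · rw [← op_single]
    congr 1
    ext1 k
    rw [Finsupp.single_apply]
    split_ifs with hk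
    · rw [hk]
    · by_contra hc
      have hk' := Finsupp.mem_support_iff.2 hc
      have := g.support.le_max' k hk'
      have := g.support.min'_le k hk'
      omega

end qDiff

namespace QSphere

variable {q : ℝ} {m : ℕ}

theorem induction {P : QSphere q m → Prop} (hz : ∀ i, P (z i)) (hzs : ∀ i, P (zs i))
    (halg : ∀ c : ℂ, P (algebraMap ℂ _ c)) (hadd : ∀ a b, P a → P b → P (a + b))
    (hmul : ∀ a b, P a → P b → P (a * b)) (a : QSphere q m) : P a := by
  obtain ⟨x, rfl⟩ := mk_surjective a
  induction x using FreeAlgebra.induction with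
  | grade0 c => rw [AlgHom.commutes]; exact halg c
  | grade1 x =>
    cases x with
    | inl i => exact hz i
    | inr i => exact hzs i
  | mul x y hx hy => rw [map_mul]; exact hmul _ _ hx hy
  | add x y hx hy => rw [map_add]; exact hadd _ _ hx hy

/-! ### A representation of the quantum sphere -/

section LiftTwo

variable {B : Type*} [Ring B]

variable (m) in
/-- The family with entries `a`, `x`, `0`, …, `0`. -/
def pairFamily (a x : B) (i : Fin (m / 2 + 1)) : B :=
  if i.val = 0 then a else if i.val = 1 then x else 0

theorem pairFamily_zero (a x : B) {i : Fin (m / 2 + 1)} (h : i.val = 0) :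
    pairFamily m a x i = a := if_pos h

theorem pairFamily_one (a x : B) {i : Fin (m / 2 + 1)} (h : i.val = 1) :
    pairFamily m a x i = x := by
  rw [pairFamily, if_neg (by omega), if_pos h]

theorem pairFamily_of_two_le (a x : B) {i : Fin (m / 2 + 1)} (h : 2 ≤ i.val) :
    pairFamily m a x i = 0 := by
  rw [pairFamily, if_neg (by omega), if_neg (by omega)]

variable (m) in
/-- A homomorphism `O(S^2_q) → B`, given by the images `a`, `a'`, `x` of `z_0`, `z_0^*`,
`z_1 = z_1^*`, composed with the quotient map `O(S^m_q) → O(S^2_q)`. -/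
def liftTwo [Algebra ℂ B] (hm : 1 < m) (a a' x : B) (h₁ : a * x = (q : ℂ) • (x * a))
    (h₂ : x * a' = (q : ℂ) • (a' * x))
    (h₃ : a * a' = a' * a + ((q : ℂ) ^ (-2 : ℤ) - 1) • (x * x)) (h₄ : a * a' + x * x = 1) :
    QSphere q m →ₐ[ℂ] B := by
  have hn : 1 < m / 2 + 1 := by omega
  have cases (i : Fin (m / 2 + 1)) : i.val = 0 ∨ i.val = 1 ∨ 2 ≤ i.val := by omega
  refine lift (pairFamily m a x) (pairFamily m a' x) (fun i j h => ?_) (fun i j h => ?_)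
    (fun i j h => ?_) (fun i => ?_) ?_ (fun h => ?_)
  · have h : i.val < j.val := h
    rcases cases j with hj | hj | hj
    · omega
    · rw [pairFamily_one _ _ hj, pairFamily_zero _ _ (i := i) (by omega), h₁]
    · rw [pairFamily_of_two_le _ _ hj, mul_zero, zero_mul, smul_zero]
  · have h : i.val < j.val := h
    rcases cases j with hj | hj | hj
    · omega
    · rw [pairFamily_one _ _ hj, pairFamily_zero _ _ (i := i) (by omega), h₂]
    · rw [pairFamily_of_two_le _ _ hj, mul_zero, zero_mul, smul_zero]
  · have h : i.val ≠ j.val := fun hc => h (Fin.ext hc)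
    rcases cases i with hi | hi | hi
    · rcases cases j with hj | hj | hj
      · omega
      · rw [pairFamily_zero _ _ hi, pairFamily_one _ _ hj, h₁]
      · rw [pairFamily_of_two_le _ _ hj, mul_zero, zero_mul, smul_zero]
    · rcases cases j with hj | hj | hj
      · rw [pairFamily_one _ _ hi, pairFamily_zero _ _ hj, h₂]
      · omega
      · rw [pairFamily_of_two_le _ _ hj, mul_zero, zero_mul, smul_zero]
    · rw [pairFamily_of_two_le _ _ hi, mul_zero, zero_mul, smul_zero]
  · by_cases hi : i.val = 0
    · rw [Finset.sum_eq_single (⟨1, hn⟩ : Fin (m / 2 + 1)), pairFamily_zero _ _ hi,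
        pairFamily_zero _ _ hi, pairFamily_one _ _ rfl, pairFamily_one _ _ rfl, h₃]
      · intro b hb hb1
        have h0 : i.val < b.val := Fin.lt_def.1 (Finset.mem_Ioi.1 hb)
        have h1 : b.val ≠ 1 := fun hc => hb1 (Fin.ext hc)
        rw [pairFamily_of_two_le a x (i := b) (by omega), zero_mul]
      · exact fun hc => absurd (Finset.mem_Ioi.2 (Fin.lt_def.2 (by rw [hi]; exact one_pos))) hc
    · rw [Finset.sum_eq_zero, smul_zero, add_zero]
      · simp only [pairFamily, if_neg hi]
      · intro b hb
        have h0 : i.val < b.val := Fin.lt_def.1 (Finset.mem_Ioi.1 hb)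
        rw [pairFamily_of_two_le a x (i := b) (by omega), zero_mul]
  · rw [Finset.sum_eq_add (⟨0, by omega⟩ : Fin (m / 2 + 1)) ⟨1, hn⟩ (by simp)]
    · rw [pairFamily_zero _ _ rfl, pairFamily_zero _ _ rfl, pairFamily_one _ _ rfl,
        pairFamily_one _ _ rfl, h₄]
    · rintro c - ⟨h0, h1⟩
      have h0' : c.val ≠ 0 := fun hc => h0 (Fin.ext hc)
      have h1' : c.val ≠ 1 := fun hc => h1 (Fin.ext hc)
      rw [pairFamily_of_two_le a x (i := c) (by omega), zero_mul]
    · simp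
    · simp
  · have : (Fin.last (m / 2)).val ≠ 0 := by rw [Fin.val_last]; omega
    simp only [pairFamily, if_neg this]

end LiftTwo

open Polynomial

variable (m) in
/-- The representation of `O(S^m_q)`, `1 < m`, by `q`-difference operators on functions of `s` and
`w`: `z_0` acts by `φ(s, w) ↦ w * φ(q * s, w)`, `z_1` by multiplication by `s`, and `z_i` by zero
for `1 < i`. -/
def rep (hq0 : 0 < q) (hm : 1 < m) : QSphere q m →ₐ[ℂ] Module.End ℂ (ℂ × ℂˣ → ℂ) :=
  have hq : (q : ℂ) ≠ 0 := by exact_mod_cast hq0.ne'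
  liftTwo m hm (qDiff q 1 1) (qDiff q (-1) (1 - C ((q : ℂ) ^ (-2 : ℤ)) * X ^ 2)) (qDiff q 0 X)
    (by
      rw [qDiff.mul hq, qDiff.mul hq, ← LinearMap.map_smul]
      congr 1
      exact Polynomial.funext fun t => by simp)
    (by
      rw [qDiff.mul hq, qDiff.mul hq, ← LinearMap.map_smul]
      congr 1
      refine Polynomial.funext fun t => ?_
      simp [-Complex.coe_smul]
      field_simp)
    (by
      rw [qDiff.mul hq, qDiff.mul hq, qDiff.mul hq, ← LinearMap.map_smul]
      simp only [add_neg_cancel, neg_add_cancel, add_zero]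
      rw [← map_add]
      congr 1
      refine Polynomial.funext fun t => ?_
      simp [-Complex.coe_smul]
      field_simp
      ring)
    (by
      rw [qDiff.mul hq, qDiff.mul hq, ← qDiff.zero_one]
      simp only [add_neg_cancel, add_zero]
      rw [← map_add]
      congr 1
      refine Polynomial.funext fun t => ?_
      simp
      field_simp
      ring)

section

variable (hq0 : 0 < q) (hm : 1 < m)

theorem rep_z (i) : rep m hq0 hm (z i) =
    pairFamily m (qDiff q 1 1) (qDiff q 0 X) i := by
  rw [rep, liftTwo, lift_z]

theorem rep_zs (i) : rep m hq0 hm (zs i) =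
    pairFamily m (qDiff q (-1) (1 - C ((q : ℂ) ^ (-2 : ℤ)) * X ^ 2)) (qDiff q 0 X) i := by
  rw [rep, liftTwo, lift_zs]

theorem rep_mem_range_op (a : QSphere q m) :
    rep m hq0 hm a ∈ LinearMap.range (qDiff.op q) := by
  have hq : (q : ℂ) ≠ 0 := by exact_mod_cast hq0.ne'
  have hd (k : ℤ) (p : ℂ[X]) : qDiff q k p ∈ LinearMap.range (qDiff.op q) :=
    ⟨_, qDiff.op_single k p⟩
  induction a using induction with
  | hz i => rw [rep_z, pairFamily]; split_ifs <;> first | exact hd _ _ | exact zero_mem _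
  | hzs i => rw [rep_zs, pairFamily]; split_ifs <;> first | exact hd _ _ | exact zero_mem _
  | halg c =>
    rw [AlgHom.commutes, Algebra.algebraMap_eq_smul_one, ← qDiff.zero_one]
    exact Submodule.smul_mem _ _ (hd _ _)
  | hadd a b ha hb => rw [map_add]; exact add_mem ha hb
  | hmul a b ha hb => rw [map_mul]; exact qDiff.op_mul_mem hq ha hb

/-- The functions which vanish at `s = q, q ^ 2, q ^ 3, …` are preserved by the representation:
`z_0^*` does not carry the value at `s = 1` to `s = q`, since `1 - q ^ (-2) * s ^ 2` vanishes at
`s = q`. -/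
theorem rep_apply_eq_zero (a : QSphere q m) (φ : ℂ × ℂˣ → ℂ)
    (hφ : ∀ j : ℕ, ∀ w, φ ((q : ℂ) ^ (j + 1), w) = 0) (j : ℕ) (w : ℂˣ) :
    rep m hq0 hm a φ ((q : ℂ) ^ (j + 1), w) = 0 := by
  have hq : (q : ℂ) ≠ 0 := by exact_mod_cast hq0.ne'
  induction a using induction generalizing φ j w with
  | hz i =>
    rw [rep_z, pairFamily]
    split_ifs
    · have := hφ (j + 1) w
      rw [pow_succ'] at this
      simp [qDiff.apply, this]
    · simp [qDiff.apply, hφ]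
    · rfl
  | hzs i =>
    rw [rep_zs, pairFamily]
    split_ifs
    · rw [qDiff.apply]
      cases j with
      | zero => simp [hq]
      | succ j =>
        rw [show (q : ℂ) ^ (-1 : ℤ) * (q : ℂ) ^ (j + 1 + 1) = (q : ℂ) ^ (j + 1) by
          rw [zpow_neg_one, pow_succ' _ (j + 1), inv_mul_cancel_left₀ hq], hφ, mul_zero]
    · simp [qDiff.apply, hφ]
    · rfl
  | halg c => simp [AlgHom.commutes, hφ]
  | hadd a b ha hb => simp [map_add, ha φ hφ, hb φ hφ]
  | hmul a b ha hb =>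
    rw [map_mul]
    exact ha _ (hb φ hφ) _ _

end

/-! ### Units of the quantum sphere -/

/-- The automorphism of `O(S^m_q)` which changes the sign of all generators: the action of the
nontrivial character of `O(ℤ/2)`. -/
def signHom : QSphere q m →ₐ[ℂ] QSphere q m :=
  (Algebra.TensorProduct.lift (AlgHom.id ℂ _)
    ((Algebra.ofId ℂ _).comp (AddMonoidAlgebra.lift ℂ ℂ (ZMod 2)
      (AddChar.zmodChar 2 (ζ := (-1 : ℂ)) (by norm_num)).toMonoidHom))
    fun a h => (show Commute a (algebraMap ℂ _ _) from (Algebra.commutes _ _).symm)).comp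
      (coaction q m)

theorem signHom_of_coaction {a b : QSphere q m} (ha : coaction q m a = b ⊗ₜ OZ2.u) :
    signHom a = -b := by
  rw [signHom, AlgHom.comp_apply, ha]
  refine (Algebra.TensorProduct.lift_tmul _ _ _ _ _).trans ?_
  rw [OZ2.u, AlgHom.comp_apply,
    AddMonoidAlgebra.lift_single]
  simp [AddChar.zmodChar_apply, Algebra.ofId_apply, ZMod.val_one]

/-- The substitution `φ(s, w) ↦ φ(-s, -w)` implements the sign automorphism. -/
theorem rep_signHom (hq0 : 0 < q) (hm : 1 < m) (a : QSphere q m) (φ : ℂ × ℂˣ → ℂ)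
    (x : ℂ × ℂˣ) :
    rep m hq0 hm (signHom a) φ x = rep m hq0 hm a (fun y => φ (-y)) (-x) := by
  induction a using induction generalizing φ x with
  | hz i =>
    obtain ⟨s, w⟩ := x
    rw [signHom_of_coaction (coaction_z i), map_neg, rep_z, pairFamily]
    split_ifs <;> simp [qDiff.apply]
  | hzs i =>
    obtain ⟨s, w⟩ := x
    rw [signHom_of_coaction (coaction_zs i), map_neg, rep_zs, pairFamily]
    split_ifs <;> simp [qDiff.apply, sub_eq_add_neg, add_comm]
  | halg c => simp
  | hadd a b ha hb => simp [ha, hb]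
  | hmul a b ha hb =>
    rw [map_mul, map_mul, map_mul, Module.End.mul_apply, Module.End.mul_apply, ha]
    refine congrArg (fun ψ => rep m hq0 hm a ψ (-x)) (funext fun y => ?_)
    rw [hb, neg_neg]

/-- The algebra `O(S^m_q)`, `1 < m`, has no odd units. -/
theorem not_isUnit_of_coaction_eq_tmul_u (hq0 : 0 < q) (hq1 : q < 1) (hm : 1 < m)
    {a : QSphere q m} (ha : coaction q m a = a ⊗ₜ OZ2.u) : ¬ IsUnit a := by
  rintro ⟨⟨a, b, hab, hba⟩, rfl⟩
  have hq : (q : ℂ) ≠ 0 := by exact_mod_cast hq0.ne'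
  obtain ⟨f, hf⟩ := rep_mem_range_op hq0 hm a
  obtain ⟨g, hg⟩ := rep_mem_range_op hq0 hm b
  have hfg : qDiff.op (q : ℂ) f * qDiff.op (q : ℂ) g = 1 := by
    rw [hf, hg, ← map_mul, hab, map_one]
  have hgf : qDiff.op (q : ℂ) g * qDiff.op (q : ℂ) f = 1 := by
    rw [hf, hg, ← map_mul, hba, map_one]
  obtain ⟨K, p, r, hp, hr⟩ := qDiff.exists_eq_single hq0 hq1 hfg
  rw [hp, hr] at hfg hgf
  rw [hp] at hf
  rw [hr] at hg
  -- the characteristic function of `s = 1`, which vanishes at `s = q, q ^ 2, …`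
  let φ : ℂ × ℂˣ → ℂ := fun x => if x.1 = 1 then 1 else 0
  have hφ (j : ℕ) (w : ℂˣ) : φ ((q : ℂ) ^ (j + 1), w) = 0 := by
    refine if_neg fun hc => ?_
    have : q ^ (j + 1) = 1 := by exact_mod_cast (show (q : ℂ) ^ (j + 1) = 1 from hc)
    exact (pow_lt_one₀ hq0.le hq1 (Nat.succ_ne_zero j)).ne this
  rcases lt_trichotomy K 0 with hK | rfl | hK
  -- in the nonzero cases, the coefficient carrying the value at `1` to `q ^ (j + 1)` both vanishes
  -- and is invertible
  · obtain ⟨j, rfl⟩ : ∃ j : ℕ, K = -((j : ℤ) + 1) := ⟨(-K - 1).toNat, by omega⟩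
    have h1 := congrFun (LinearMap.congr_fun hfg fun _ => 1) ((q : ℂ) ^ (j + 1), 1)
    have h2 := rep_apply_eq_zero hq0 hm a φ hφ j 1
    rw [← hf, qDiff.apply,
      show φ ((q : ℂ) ^ (-((j : ℤ) + 1)) * (q : ℂ) ^ (j + 1), 1) = 1 from if_pos (by
        rw [← zpow_natCast, ← zpow_add₀ hq]; simp)] at h2
    simp [qDiff.apply] at h1 h2
    simp [h2] at h1
  · have h1 := congrFun (LinearMap.congr_fun hfg fun _ => 1) (0, 1)
    have h2 := rep_signHom hq0 hm a (fun _ => 1) (0, 1)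
    rw [signHom_of_coaction ha, map_neg, ← hf] at h2
    simp [qDiff.apply] at h1 h2
    have h3 : p.eval 0 = 0 := by linear_combination (-1 / 2) * h2
    simp [h3] at h1
  · obtain ⟨j, rfl⟩ : ∃ j : ℕ, K = (j : ℤ) + 1 := ⟨(K - 1).toNat, by omega⟩
    have h1 := congrFun (LinearMap.congr_fun hgf fun _ => 1) ((q : ℂ) ^ (j + 1), 1)
    have h2 := rep_apply_eq_zero hq0 hm b φ hφ j 1
    rw [← hg, qDiff.apply,
      show φ ((q : ℂ) ^ (-((j : ℤ) + 1)) * (q : ℂ) ^ (j + 1), 1) = 1 from if_pos (by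
        rw [← zpow_natCast, ← zpow_add₀ hq]; simp)] at h2
    simp [qDiff.apply] at h1 h2
    simp [h2] at h1

end QSphere

/-! ### Comodule algebras over `O(U(1))` -/

open LaurentPolynomial (T)

theorem OU1.linearMap_ext {M : Type*} [AddCommMonoid M] [Module ℂ M] {f g : OU1 →ₗ[ℂ] M}
    (h : ∀ n, f (T n) = g (T n)) : f = g :=
  AddMonoidAlgebra.lhom_ext' fun n => LinearMap.ext_ring (h n)

theorem OU1.antipode_bijective :
    Function.Bijective (HopfAlgebra.antipode ℂ : OU1 →ₗ[ℂ] OU1) := by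
  have h : (HopfAlgebra.antipode ℂ : OU1 →ₗ[ℂ] OU1) ∘ₗ HopfAlgebra.antipode ℂ = LinearMap.id :=
    OU1.linearMap_ext fun n => by simp
  exact Function.Involutive.bijective fun x => LinearMap.congr_fun h x

theorem piTwo_T_eq_single (n : ℤ) : piTwo (T n) = AddMonoidAlgebra.single (n : ZMod 2) 1 := by
  simp [piTwo, LaurentPolynomial.T, -LaurentPolynomial.single_eq_C_mul_T]

theorem piTwo_T_of_even {n : ℤ} (h : Even n) : piTwo (T n) = 1 := by
  rw [piTwo_T_eq_single, (ZMod.intCast_eq_zero_iff_even).2 h, AddMonoidAlgebra.one_def]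

theorem piTwo_T_of_odd {n : ℤ} (h : Odd n) : piTwo (T n) = OZ2.u := by
  rw [piTwo_T_eq_single, (ZMod.intCast_eq_one_iff_odd).2 h, OZ2.u]

namespace RightComoduleAlgebra

/-- A comodule algebra over `O(U(1))`, that is, a `ℤ`-graded algebra, is principal if the unit is a
sum of products of elements of degrees `-n` and `n`, for every `n`. -/
theorem isPrincipal_of_sum_mul_eq_one {A : Type*} [Ring A] [Algebra ℂ A]
    [RightComoduleAlgebra OU1 A]
    (h : ∀ n : ℤ, ∃ (k : ℕ) (x y : Fin k → A), ∑ i, x i * y i = 1 ∧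
      (∀ i, coact (H := OU1) (x i) = x i ⊗ₜ T (-n)) ∧
      (∀ i, coact (H := OU1) (y i) = y i ⊗ₜ T n)) :
    IsPrincipal OU1 A := by
  choose k x y hxy hx hy using h
  -- the value at `T 0` is prescribed by unitality of the strong connection
  let t (n : ℤ) : A ⊗[ℂ] A := if n = 0 then 1 ⊗ₜ 1 else ∑ i, x n i ⊗ₜ y n i
  have ht {P : ℤ → A ⊗[ℂ] A → Prop} (h0 : P 0 (1 ⊗ₜ 1)) (hs : ∀ n, P n (∑ i, x n i ⊗ₜ y n i))
      (n : ℤ) : P n (t n) := by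
    by_cases hn : n = 0
    · subst hn; rw [show t 0 = 1 ⊗ₜ 1 from if_pos rfl]; exact h0
    · rw [show t n = ∑ i, x n i ⊗ₜ y n i from if_neg hn]; exact hs n
  let l : OU1 →ₗ[ℂ] A ⊗[ℂ] A :=
    Finsupp.linearCombination ℂ t ∘ₗ (AddMonoidAlgebra.coeffLinearEquiv ℂ).toLinearMap
  have hl (n : ℤ) : l (T n) = t n := by
    simp [l, LaurentPolynomial.T, -LaurentPolynomial.single_eq_C_mul_T]
  refine ⟨OU1.antipode_bijective, l, ?_, ?_, ?_, ?_⟩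
  · rw [← LaurentPolynomial.T_zero, hl]
    exact if_pos rfl
  · refine OU1.linearMap_ext fun n => ?_
    simp only [LinearMap.comp_apply, hl, LaurentPolynomial.counit_T]
    exact ht (P := fun _ s => LinearMap.mul' ℂ A s = Algebra.linearMap ℂ A 1) (by simp)
      (fun n => by simp [hxy]) n
  · refine OU1.linearMap_ext fun n => ?_
    simp only [LinearMap.comp_apply, LaurentPolynomial.comul_T, TensorProduct.map_tmul, hl]
    exact ht (P := fun n s => TensorProduct.assoc ℂ A A OU1 (s ⊗ₜ T n) =
        TensorProduct.map LinearMap.id (coact (H := OU1) (A := A)).toLinearMap s)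
      (by simp [Algebra.TensorProduct.one_def]) (fun n => by simp [TensorProduct.sum_tmul, hy]) n
  · refine OU1.linearMap_ext fun n => ?_
    simp only [LinearMap.comp_apply, LaurentPolynomial.comul_T, TensorProduct.map_tmul, hl,
      LaurentPolynomial.antipode_T]
    exact ht (P := fun n s => T (-n) ⊗ₜ s = TensorProduct.assoc ℂ OU1 A A
        (TensorProduct.map (TensorProduct.comm ℂ A OU1).toLinearMap LinearMap.id
          (TensorProduct.map (coact (H := OU1) (A := A)).toLinearMap LinearMap.id s)))
      (by simp [Algebra.TensorProduct.one_def]) (fun n => by simp [TensorProduct.tmul_sum, hx]) n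

variable {A : Type*} [Ring A] [Algebra ℂ A]

theorem IsColinear.coact_T [RightComoduleAlgebra OU1 A] {j : OU1 →ₗ[ℂ] A}
    (hj : IsColinear j) (n : ℤ) :
    coact (H := OU1) (j (T n)) = j (T n) ⊗ₜ[ℂ] T n := by
  simpa using LinearMap.congr_fun hj (T n)

/-- Convolution inverses are inverses on the grouplike elements `T n`. -/
theorem IsConvInvertible.isUnit_T {j : OU1 →ₗ[ℂ] A} (hj : IsConvInvertible j) (n : ℤ) :
    IsUnit (j (T n)) := by
  obtain ⟨k, h₁, h₂⟩ := hj
  have h₁ := LinearMap.congr_fun h₁ (T n)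
  have h₂ := LinearMap.congr_fun h₂ (T n)
  simp at h₁ h₂
  exact ⟨⟨_, _, h₁, h₂⟩, rfl⟩

end RightComoduleAlgebra

open RightComoduleAlgebra

/-! ### Homogeneous elements of the prolongation -/

namespace Prolongation

variable {A : Type*} [Ring A] [Algebra ℂ A] [RightComoduleAlgebra OZ2 A]

theorem tmul_T_mem {a : A} {n : ℤ} (h : coact (H := OZ2) a = a ⊗ₜ piTwo (T n)) :
    a ⊗ₜ T n ∈ Prolongation A piTwo := by
  change cotensorLeft A _ = cotensorRight A piTwo _
  simp [cotensorLeft, cotensorRight, h]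

theorem coact_mk_tmul_T {a : A} {n : ℤ} (h : a ⊗ₜ T n ∈ Prolongation A piTwo) :
    coact (H := OU1) (⟨a ⊗ₜ T n, h⟩ : Prolongation A piTwo) = ⟨a ⊗ₜ T n, h⟩ ⊗ₜ T n := by
  refine incl_injective A piTwo ((incl_coaction A piTwo _).trans ?_)
  simp [incl, idComul]

/-- The projection `id ⊗ ε : A ⊗ O(U(1)) → A`, restricted to the prolongation. -/
def toBase : Prolongation A piTwo →ₐ[ℂ] A :=
  (Algebra.TensorProduct.rid ℂ ℂ A).toAlgHom.comp
    ((Algebra.TensorProduct.map (AlgHom.id ℂ A) (Bialgebra.counitAlgHom ℂ OU1)).comp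
      (Prolongation A piTwo).val)

/-- The homogeneous elements of degree `n` are of the form `a ⊗ T n`. -/
theorem eq_tmul_T_of_coact {x : Prolongation A piTwo} {n : ℤ}
    (h : coact (H := OU1) x = x ⊗ₜ T n) : (x : A ⊗[ℂ] OU1) = toBase x ⊗ₜ T n := by
  have h1 : idComul A OU1 x = (x : A ⊗[ℂ] OU1) ⊗ₜ T n := by
    rw [← incl_coaction A piTwo x]
    exact (congrArg (incl A piTwo) h).trans (by simp [incl])
  -- applying the counit to the middle factor undoes `id ⊗ Δ`
  let F : (A ⊗[ℂ] OU1) ⊗[ℂ] OU1 →ₐ[ℂ] A ⊗[ℂ] OU1 :=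
    Algebra.TensorProduct.map ((Algebra.TensorProduct.rid ℂ ℂ A).toAlgHom.comp
      (Algebra.TensorProduct.map (AlgHom.id ℂ A) (Bialgebra.counitAlgHom ℂ OU1)))
      (AlgHom.id ℂ OU1)
  have hF : F.toLinearMap ∘ₗ (idComul A OU1).toLinearMap = LinearMap.id := by
    refine TensorProduct.ext (LinearMap.ext fun a => OU1.linearMap_ext fun k => ?_)
    simp [F, idComul]
  have h2 := LinearMap.congr_fun hF (x : A ⊗[ℂ] OU1)
  simp only [LinearMap.comp_apply, AlgHom.toLinearMap_apply, h1] at h2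
  exact h2.symm

theorem coact_toBase {x : Prolongation A piTwo} {n : ℤ}
    (h : coact (H := OU1) x = x ⊗ₜ T n) :
    coact (H := OZ2) (toBase x) = toBase x ⊗ₜ piTwo (T n) := by
  have hx : cotensorLeft A (x : A ⊗[ℂ] OU1) = cotensorRight A piTwo x := x.2
  rw [eq_tmul_T_of_coact h] at hx
  have := congrArg (Algebra.TensorProduct.rid ℂ ℂ (A ⊗[ℂ] OZ2))
    (congrArg (Algebra.TensorProduct.map (AlgHom.id ℂ (A ⊗[ℂ] OZ2))
      (Bialgebra.counitAlgHom ℂ OU1)) hx)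
  simpa [cotensorLeft, cotensorRight] using this

end Prolongation

/-! ### Prolongations of the quantum spheres -/

namespace QSphere

variable {q : ℝ} {m : ℕ}

theorem isPrincipal_prolongation : IsPrincipal OU1 (Prolongation (QSphere q m) piTwo) := by
  refine isPrincipal_of_sum_mul_eq_one fun n => ?_
  have hT : (T (-n) * T n : OU1) = 1 := by
    rw [← LaurentPolynomial.T_add, neg_add_cancel, LaurentPolynomial.T_zero]
  rcases Int.even_or_odd n with hn | hn
  · have h1 {k : ℤ} (hk : Even k) :
        (1 : QSphere q m) ⊗ₜ[ℂ] T k ∈ Prolongation (QSphere q m) piTwo :=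
      Prolongation.tmul_T_mem
        (by rw [piTwo_T_of_even hk, map_one, Algebra.TensorProduct.one_def])
    refine ⟨1, fun _ => ⟨_, h1 hn.neg⟩, fun _ => ⟨_, h1 hn⟩, ?_,
      fun _ => Prolongation.coact_mk_tmul_T _, fun _ => Prolongation.coact_mk_tmul_T _⟩
    refine Subtype.ext ?_
    simp [hT, ← Algebra.TensorProduct.one_def]
  · have hz (i) {k : ℤ} (hk : Odd k) :
        (z i : QSphere q m) ⊗ₜ[ℂ] T k ∈ Prolongation (QSphere q m) piTwo :=
      Prolongation.tmul_T_mem (by rw [piTwo_T_of_odd hk]; exact coaction_z i)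
    have hzs (i) {k : ℤ} (hk : Odd k) :
        (zs i : QSphere q m) ⊗ₜ[ℂ] T k ∈ Prolongation (QSphere q m) piTwo :=
      Prolongation.tmul_T_mem (by rw [piTwo_T_of_odd hk]; exact coaction_zs i)
    refine ⟨m / 2 + 1, fun i => ⟨_, hz i hn.neg⟩, fun i => ⟨_, hzs i hn⟩, ?_,
      fun _ => Prolongation.coact_mk_tmul_T _, fun _ => Prolongation.coact_mk_tmul_T _⟩
    refine Subtype.ext ?_
    simp [hT, ← Algebra.TensorProduct.one_def, ← TensorProduct.sum_tmul, radius]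

/-- The prolongation has no units of degree one: its homogeneous elements of degree one are
`a ⊗ T 1` with `a` odd. -/
theorem not_isUnit_of_coact_eq_tmul_T_one (hq0 : 0 < q) (hq1 : q < 1) (hm : 1 < m)
    {x : Prolongation (QSphere q m) piTwo} (hx : coact (H := OU1) x = x ⊗ₜ T 1) :
    ¬ IsUnit x := by
  intro h
  refine not_isUnit_of_coaction_eq_tmul_u hq0 hq1 hm ?_ (h.map Prolongation.toBase)
  exact (Prolongation.coact_toBase hx).trans (by rw [piTwo_T])

end QSphere

end

theorem proposition5p1 (q : ℝ) (hq0 : 0 < q) (hq1 : q < 1) (m : ℕ) (hm : 1 < m) :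
    RightComoduleAlgebra.IsPrincipal OU1 (Prolongation (QSphere q m) piTwo) ∧
      ¬ RightComoduleAlgebra.IsTrivial OU1 (Prolongation (QSphere q m) piTwo) ∧
      ¬ RightComoduleAlgebra.IsCleft OU1 (Prolongation (QSphere q m) piTwo) := by
  refine ⟨QSphere.isPrincipal_prolongation, ?_, ?_⟩
  · rintro ⟨-, j, hj⟩
    exact QSphere.not_isUnit_of_coact_eq_tmul_T_one hq0 hq1 hm
      (RightComoduleAlgebra.IsColinear.coact_T hj 1)
      ((LaurentPolynomial.isUnit_T 1).map j)
  · rintro ⟨-, j, -, hj, hinv⟩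
    exact QSphere.not_isUnit_of_coact_eq_tmul_T_one hq0 hq1 hm
      (RightComoduleAlgebra.IsColinear.coact_T hj 1) (hinv.isUnit_T 1)
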